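/- Let $m$ be a number of items, let $[m]=\{1,\dots,m\}$, and call a function $v:2^{[m]}\to\mathbb R$ a valuation if it is monotone ($v(S)\le v(T)$ for $S\subseteq T$) and normalized ($v(\emptyset)=0$). Let $\mathsf{XOS}_m$ be the set of valuations for which there is a collection $\mathcal C\subseteq\mathbb R^m$ with $v(S)=\max_{c\in\mathcal C}\sum_{j\in S}c_j$ for all $S\subseteq [m]$, and let $\mathsf{SingleM}_m$ be the set of valuations for which there are $w\ge 0$ and $T\subseteq[m]$ with $v(S)=w$ if $S\supseteq T$ and $v(S)=0$ otherwise. A valuation has precision $k$ if all its values lie in $\{0\}\cup\{x/2^k: x\in\{1,\dots,2^{2k}\}\}$. For a class $\mathcal V$ of valuations, a (deterministic) mechanism for two bidders with valuations in $\mathcal V$ is a function $\mathcal A=(f,p)$ that maps every $(v_1,v_2)\in\mathcal V^2$ to an allocation $f(v_1,v_2)=(f_1,f_2)$, that is, a pair of disjoint subsets of $[m]$, and to payments $p(v_1,v_2)=(p_1,p_2)\in\mathbb R^2$. It is truthful if for every bidder $i$, every profile $(v_i,v_{-i})\in\mathcal V^2$ and every $v_i'\in\mathcal V$, $$v_i(f_i(v_i,v_{-i}))-p_i(v_i,v_{-i})\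 \ge\ v_i(f_i(v_i',v_{-i}))-p_i(v_i',v_{-i}),$$ and it guarantees an $\alpha$-approximation if for every profile $(v_1,v_2)\in\mathcal V^2$ $$v_1(f_1(v_1,v_2))+v_2(f_2(v_1,v_2))\ \ge\ \alpha\cdot\max_{S_1\cap S_2=\emptyset}\big(v_1(S_1)+v_2(S_2)\big).$$ Its communication complexity $\operatorname{cc}(\mathcal A)\in\mathbb N\cup\{\infty\}$ is the least worst-case number of bits of a deterministic two-party protocol that, with bidder $i$ knowing $v_i$ only, computes both the allocation and the payments ($\infty$ if no such protocol exists). **Theorem.** There are a constant $c>0$, a polynomial $q$ with coefficients in $\mathbb N$ and a number $m_0$ such that the following holds for all $m\ge m_0$ and all $k\ge q(m)$. Let $\mathcal V\subseteq\mathsf{XOS}_m\cup\mathsf{SingleM}_m$ be any class that contains all valuations of $\mathsf{XOS}_m\cup\mathsf{SingleM}_m$ of precision $k$ (for instance exactly these valuations, or all of $\mathsf{XOS}_m\cup\mathsf{SingleM}_m$). Then every deterministic truthful mechanism $\mathcal A$ for two bidders with valuations in $\mathcal V$ that guarantees a $\left(\frac{\sqrt5-1}{2}+3m^{-1/3}\right)$-approximation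 to the optimal social welfare satisfies $$\operatorname{cc}(\mathcal A)\ \ge\ \exp\!\left(c\, m^{1/3}\right).$$ -/

import Mathlib

namespace CombAuction

/-! ### Valuations over the item set `Fin m` -/

/-- A set function on the bundles of items. -/
abbrev SetFun (m : ℕ) : Type := Finset (Fin m) → ℝ

/-- Valuations are monotone non-decreasing and normalized. -/
def IsValuation {m : ℕ} (v : SetFun m) : Prop :=
  (∀ S T : Finset (Fin m), S ⊆ T → v S ≤ v T) ∧ v ∅ = 0

/-- XOS valuations: `v S` is the maximum, over a collection of additive clauses, of the value that
the clause gives to `S`. -/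
def XOS (m : ℕ) : Set (SetFun m) :=
  {v | IsValuation v ∧ ∃ C : Set (Fin m → ℝ),
    ∀ S : Finset (Fin m), IsGreatest {x : ℝ | ∃ c ∈ C, x = ∑ j ∈ S, c j} (v S)}

/-- Single-minded valuations: a weight `w ≥ 0` for all bundles that contain the desired set `T`,
and `0` for the others. -/
def SingleM (m : ℕ) : Set (SetFun m) :=
  {v | IsValuation v ∧ ∃ (w : ℝ) (T : Finset (Fin m)), 0 ≤ w ∧
    ∀ S : Finset (Fin m), v S = if T ⊆ S then w else 0}

/-- Precision `k`: every value is `0` or `x / 2 ^ k` for some `x ∈ {1, …, 2 ^ (2 k)}`. -/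
def HasPrecision {m : ℕ} (k : ℕ) (v : SetFun m) : Prop :=
  ∀ S : Finset (Fin m), ∃ x : ℕ, x ≤ 2 ^ (2 * k) ∧ v S = (x : ℝ) / 2 ^ k

/-! ### Auction rules -/

/-- Allocations of the `m` items to `n` bidders: pairwise disjoint bundles (items may stay
unallocated). -/
abbrev Allocation (n m : ℕ) : Type :=
  {a : Fin n → Finset (Fin m) // ∀ i j : Fin n, i ≠ j → Disjoint (a i) (a j)}

/-- An outcome: an allocation and a payment of each bidder. -/
structure Outcome (n m : ℕ) where
  alloc : Allocation n m
  pay : Fin n → ℝ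

/-- A (deterministic) auction rule for `n` bidders whose valuations are in `V`. -/
abbrev AuctionRule (n : ℕ) {m : ℕ} (V : Set (SetFun m)) : Type := (Fin n → V) → Outcome n m

/-- The utility of a bidder with valuation `v`, as bidder `i` in outcome `o`. -/
def utility {n m : ℕ} (v : SetFun m) (i : Fin n) (o : Outcome n m) : ℝ :=
  v (o.alloc.1 i) - o.pay i

/-- Truthfulness: no bidder can gain by reporting another valuation of the class. -/
def Truthful {n m : ℕ} {V : Set (SetFun m)} (A : AuctionRule n V) : Prop :=
  ∀ (v : Fin n → V) (i : Fin n) (w : V),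
    utility (v i).1 i (A (Function.update v i w)) ≤ utility (v i).1 i (A v)

/-- The social welfare of an allocation. -/
def welfare {n m : ℕ} {V : Set (SetFun m)} (v : Fin n → V) (a : Allocation n m) : ℝ :=
  ∑ i : Fin n, (v i).1 (a.1 i)

/-- The optimal social welfare. The supremum is a maximum: there are finitely many allocations, and
at least one. -/
noncomputable def optWelfare {n m : ℕ} {V : Set (SetFun m)} (v : Fin n → V) : ℝ :=
  ⨆ a : Allocation n m, welfare v a

/-- The rule guarantees an `α`-approximation to the optimal welfare. -/
def Approximates {n m : ℕ} {V : Set (SetFun m)} (A : AuctionRule n V) (α : ℝ) : Prop :=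
  ∀ v : Fin n → V, α * optWelfare v ≤ welfare v (A v).alloc

/-! ### Communication -/

/-- Deterministic number-in-hand blackboard protocols for `n` players with inputs in `X` and outputs
in `O`. At an inner node, which is determined by the bits on the blackboard so far, player `i` writes
the bit `msg x`, where `x` is her own input; at a leaf, the bits on the blackboard determine the
output. -/
inductive Protocol (n : ℕ) (X O : Type) : Type
  | leaf (o : O) : Protocol n X O
  | node (i : Fin n) (msg : X → Bool) (onFalse onTrue : Protocol n X O) : Protocol n X O

/-- The output of a protocol on an input profile. -/
def Protocol.output {n : ℕ} {X O : Type} : Protocol n X O → (Fin n → X) → O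
  | .leaf o, _ => o
  | .node i msg onFalse onTrue, x =>
      if msg (x i) = true then onTrue.output x else onFalse.output x

/-- The number of bits written to the blackboard on an input profile. -/
def Protocol.bits {n : ℕ} {X O : Type} : Protocol n X O → (Fin n → X) → ℕ
  | .leaf _, _ => 0
  | .node i msg onFalse onTrue, x =>
      (if msg (x i) = true then onTrue.bits x else onFalse.bits x) + 1

/-- The communication cost of a protocol: the worst case of the number of bits. -/
noncomputable def Protocol.cost {n : ℕ} {X O : Type} (P : Protocol n X O) : ℕ∞ :=
  ⨆ x : Fin n → X, (P.bits x : ℕ∞)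

/-- The communication complexity of an auction rule: the least cost of a protocol that computes both
the allocation and the payments (`⊤` if there is no such protocol). -/
noncomputable def cc {n m : ℕ} {V : Set (SetFun m)} (A : AuctionRule n V) : ℕ∞ :=
  ⨅ (P : Protocol n V (Outcome n m)) (_ : ∀ v : Fin n → V, P.output v = A v), P.cost

end CombAuction

namespace CombAuction

/-! Once bidder 1's report is fixed, truthfulness makes bidder 0 face a menu of bundle prices,
measured relative to what the zero valuation pays. The approximation guarantee, applied to
single-minded deviations of bidder 0, bounds these prices from both sides (`le_utility_of_forced`,
`le_weight_of_sold`).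

Take sets `T i a` of size `l`, any two meeting in at most `t` items. For a string `b`, bidder 1
values the best `T i (b i)` and bidder 0 the best complement of a `T i (!b i)`. On `(b, b)` no
wishes match: the sold bundle `S` satisfies `v₁ S + v₂ Sᶜ ≤ m - l + t` and costs at least `α l - v₂
Sᶜ`, so bidder 0's utility is at most `m - l + t - α l`, up to rounding. On `(b, b')` with `b ≠ b'`
some `T i (!b i)` equals `T i (b' i)`; its complement costs at most about `l / α - l`, so the
utility is at least about `m - l / α`. For `t` small against `l` these bounds are incompatible once
`α ^ 2 + α > 1`, the golden ratio threshold. Hence the `2 ^ N` profiles `(b, b)` form a fooling set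
(`le_cc_of_set_family`). A code (`exists_set_family`) supplies `N = 2 ^ n`, `l = n ^ 2`, `t = 6 n`
with `n` about `m ^ (1 / 3)`. -/

/-! ### Fooling sets -/

/-- A set of input profiles such that the output is not constant on the rectangle spanned by any two
of them has at most `2 ^ c` elements, where `c` bounds the number of bits. -/
theorem Protocol.card_le_two_pow {n : ℕ} {X O : Type} (P : Protocol n X O) (c : ℕ)
    (B : Finset (Fin n → X)) (hc : ∀ x ∈ B, P.bits x ≤ c)
    (hB : ∀ x ∈ B, ∀ y ∈ B,
      (∃ o, ∀ z : Fin n → X, (∀ i, z i = x i ∨ z i = y i) → P.output z = o) → x = y) :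
    B.card ≤ 2 ^ c := by
  induction P generalizing c B with
  | leaf o =>
    have h : B.card ≤ 1 := Finset.card_le_one.2 fun x hx y hy =>
      hB x hx y hy ⟨o, fun _ _ => rfl⟩
    exact h.trans Nat.one_le_two_pow
  | node i msg P₀ P₁ ih₀ ih₁ =>
    rcases B.eq_empty_or_nonempty with rfl | ⟨x₀, hx₀⟩
    · simp
    obtain ⟨d, rfl⟩ : ∃ d, c = d + 1 := by
      have := hc x₀ hx₀
      simp only [Protocol.bits] at this
      exact ⟨c - 1, by omega⟩
    have h₁ : (B.filter fun x => msg (x i) = true).card ≤ 2 ^ d := by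
      refine ih₁ d _ (fun x hx => ?_) fun x hx y hy => ?_
      · obtain ⟨hx, hm⟩ := Finset.mem_filter.1 hx
        simpa [Protocol.bits, hm] using hc x hx
      · obtain ⟨hx, hmx⟩ := Finset.mem_filter.1 hx
        obtain ⟨hy, hmy⟩ := Finset.mem_filter.1 hy
        rintro ⟨o, ho⟩
        refine hB x hx y hy ⟨o, fun z hz => ?_⟩
        have hmz : msg (z i) = true := by rcases hz i with h | h <;> rw [h] <;> assumption
        simpa [Protocol.output, hmz] using ho z hz
    have h₀ : (B.filter fun x => ¬ msg (x i) = true).card ≤ 2 ^ d := by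
      refine ih₀ d _ (fun x hx => ?_) fun x hx y hy => ?_
      · obtain ⟨hx, hm⟩ := Finset.mem_filter.1 hx
        simpa [Protocol.bits, hm] using hc x hx
      · obtain ⟨hx, hmx⟩ := Finset.mem_filter.1 hx
        obtain ⟨hy, hmy⟩ := Finset.mem_filter.1 hy
        rintro ⟨o, ho⟩
        refine hB x hx y hy ⟨o, fun z hz => ?_⟩
        have hmz : ¬ msg (z i) = true := by rcases hz i with h | h <;> rw [h] <;> assumption
        simpa [Protocol.output, hmz] using ho z hz
    have := Finset.card_filter_add_card_filter_not (s := B) fun x => msg (x i) = true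
    rw [pow_succ]
    omega

/-- The fooling set bound for two-bidder auction rules. -/
theorem le_cc_of_fooling {m N : ℕ} {V : Set (SetFun m)} (A : AuctionRule 2 V)
    (v₁ v₂ : (Fin N → Bool) → V)
    (h : ∀ b b' : Fin N → Bool, A ![v₁ b, v₂ b] = A ![v₁ b', v₂ b'] →
      A ![v₁ b, v₂ b'] = A ![v₁ b, v₂ b] → A ![v₁ b', v₂ b] = A ![v₁ b, v₂ b] → b = b') :
    (N : ℕ∞) ≤ cc A := by
  classical
  refine le_iInf₂ fun P hP => ?_
  rcases eq_or_ne P.cost ⊤ with htop | htop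
  · simp [htop]
  obtain ⟨c, hc⟩ := ENat.ne_top_iff_exists.1 htop
  rw [← hc]
  have hbits : ∀ x, P.bits x ≤ c := fun x => by
    have : (P.bits x : ℕ∞) ≤ c := hc ▸ le_iSup (fun x => (P.bits x : ℕ∞)) x
    exact_mod_cast this
  have key : ∀ b b' : Fin N → Bool,
      (∃ o, ∀ z : Fin 2 → V, (∀ i, z i = (![v₁ b, v₂ b] : Fin 2 → V) i ∨
        z i = (![v₁ b', v₂ b'] : Fin 2 → V) i) → P.output z = o) → b = b' := by
    rintro b b' ⟨o, ho⟩
    simp only [hP] at ho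
    have e₁ := ho ![v₁ b, v₂ b] fun i => Or.inl rfl
    have e₂ := ho ![v₁ b', v₂ b'] fun i => Or.inr rfl
    have e₃ := ho ![v₁ b, v₂ b'] fun i => by fin_cases i <;> simp
    have e₄ := ho ![v₁ b', v₂ b] fun i => by fin_cases i <;> simp
    exact h b b' (e₁.trans e₂.symm) (e₃.trans e₁.symm) (e₄.trans e₁.symm)
  have hinj : Function.Injective fun b : Fin N → Bool => (![v₁ b, v₂ b] : Fin 2 → V) := by
    intro b b' hbb
    simp only at hbb
    -- If the two profiles coincide, their rectangle is a single point, so the output on it is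
    -- trivially constant.
    refine key b b' ⟨A ![v₁ b, v₂ b], fun z hz => ?_⟩
    rw [hP]
    congr 1
    funext i
    rw [← hbb] at hz
    simpa using hz i
  have hcard := P.card_le_two_pow c (Finset.univ.image fun b => (![v₁ b, v₂ b] : Fin 2 → V))
    (fun x _ => hbits x) (by
      intro x hx y hy hz
      obtain ⟨b, -, rfl⟩ := Finset.mem_image.1 hx
      obtain ⟨b', -, rfl⟩ := Finset.mem_image.1 hy
      rw [key b b' hz])
  rw [Finset.card_image_of_injective _ hinj] at hcard
  simp only [Finset.card_univ, Fintype.card_fun, Fintype.card_bool, Fintype.card_fin] at hcard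
  exact_mod_cast (Nat.pow_le_pow_iff_right (by norm_num)).1 hcard

/-! ### Coverage and single-minded valuations -/

/-- The largest number of items of a bundle in one of the sets of a family. -/
noncomputable def coverVal {m : ℕ} {ι : Type} [Fintype ι] (T : ι → Finset (Fin m)) : SetFun m :=
  fun S => ((Finset.univ.sup fun i => (S ∩ T i).card : ℕ) : ℝ)

section coverVal

variable {m : ℕ} {ι : Type} [Fintype ι] (T : ι → Finset (Fin m))

theorem card_le_coverVal (S : Finset (Fin m)) (i : ι) :
    ((S ∩ T i).card : ℝ) ≤ coverVal T S := by
  unfold coverVal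
  exact_mod_cast Finset.le_sup (f := fun i => (S ∩ T i).card) (Finset.mem_univ i)

theorem exists_coverVal_eq [Nonempty ι] (S : Finset (Fin m)) :
    ∃ i, coverVal T S = ((S ∩ T i).card : ℝ) := by
  obtain ⟨i, -, hi⟩ := Finset.exists_mem_eq_sup Finset.univ Finset.univ_nonempty
    fun i => (S ∩ T i).card
  exact ⟨i, by unfold coverVal; rw [hi]⟩

theorem coverVal_mono {S S' : Finset (Fin m)} (h : S ⊆ S') : coverVal T S ≤ coverVal T S' := by
  unfold coverVal
  exact_mod_cast Finset.sup_mono_fun fun i _ =>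
    Finset.card_le_card (Finset.inter_subset_inter_right h)

theorem coverVal_le [Nonempty ι] {l : ℕ} (hT : ∀ i, (T i).card = l) (S : Finset (Fin m)) :
    coverVal T S ≤ l := by
  obtain ⟨i, hi⟩ := exists_coverVal_eq T S
  rw [hi, ← hT i]
  exact_mod_cast Finset.card_le_card Finset.inter_subset_right

theorem coverVal_nonneg (S : Finset (Fin m)) : 0 ≤ coverVal T S := Nat.cast_nonneg _

theorem coverVal_mem_XOS [Nonempty ι] : coverVal T ∈ XOS m := by
  refine ⟨⟨fun _ _ h => coverVal_mono T h, by simp [coverVal]⟩,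
    Set.range fun i j => if j ∈ T i then 1 else 0, fun S => ⟨?_, ?_⟩⟩
  · obtain ⟨i, hi⟩ := exists_coverVal_eq T S
    exact ⟨_, ⟨i, rfl⟩, by simp [hi]⟩
  · rintro _ ⟨_, ⟨i, rfl⟩, rfl⟩
    simpa [Finset.filter_mem_eq_inter] using card_le_coverVal T S i

theorem hasPrecision_coverVal {k : ℕ} (hk : m ≤ k) : HasPrecision k (coverVal T) := by
  intro S
  refine ⟨(Finset.univ.sup fun i => (S ∩ T i).card) * 2 ^ k, ?_, ?_⟩
  · rw [two_mul, pow_add]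
    refine Nat.mul_le_mul_right _ (Finset.sup_le fun i _ => ?_)
    calc (S ∩ T i).card ≤ m := by simpa using Finset.card_le_univ (S ∩ T i)
      _ ≤ 2 ^ m := Nat.lt_two_pow_self.le
      _ ≤ 2 ^ k := Nat.pow_le_pow_right (by norm_num) hk
  · unfold coverVal
    push_cast
    field_simp

end coverVal

/-- The single-minded valuation with an integral weight. -/
noncomputable def singleVal {m : ℕ} (T : Finset (Fin m)) (w : ℕ) : SetFun m :=
  fun S => if T ⊆ S then (w : ℝ) else 0

/-- Normalization excludes a positive weight on the empty bundle. -/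
theorem singleVal_mem_SingleM {m : ℕ} {T : Finset (Fin m)} {w : ℕ} (h : T.Nonempty ∨ w = 0) :
    singleVal T w ∈ SingleM m := by
  refine ⟨⟨fun S S' hS => ?_, ?_⟩, w, T, Nat.cast_nonneg _, fun S => rfl⟩
  · unfold singleVal
    split_ifs with h₁ h₂
    · exact le_rfl
    · exact absurd (h₁.trans hS) h₂
    · exact Nat.cast_nonneg _
    · exact le_rfl
  · rcases h with h | h
    · simp [singleVal, Finset.subset_empty, h.ne_empty]
    · simp [singleVal, h]

theorem hasPrecision_singleVal {m k : ℕ} {T : Finset (Fin m)} {w : ℕ} (hw : w ≤ 2 ^ k) :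
    HasPrecision k (singleVal T w) := by
  intro S
  by_cases h : T ⊆ S
  · refine ⟨w * 2 ^ k, ?_, ?_⟩
    · rw [two_mul, pow_add]
      exact Nat.mul_le_mul_right _ hw
    · simp only [singleVal, h, if_true]
      push_cast
      field_simp
  · exact ⟨0, by simp, by simp [singleVal, h]⟩

/-! ### Prices -/

section prices

variable {m : ℕ} {V : Set (SetFun m)} {A : AuctionRule 2 V}

theorem Truthful.first (hA : Truthful A) (a a' b : V) :
    a.1 ((A ![a', b]).alloc.1 0) - (A ![a', b]).pay 0 ≤
      a.1 ((A ![a, b]).alloc.1 0) - (A ![a, b]).pay 0 := by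
  have h := hA ![a, b] 0 a'
  have e : Function.update (![a, b] : Fin 2 → V) 0 a' = ![a', b] := by
    funext i
    fin_cases i <;> simp
  rw [e] at h
  simpa [utility] using h

theorem le_welfare_of_approximates {α : ℝ} (hα : 0 ≤ α) (hA : Approximates A α) (a b : V)
    {S S' : Finset (Fin m)} (hS : Disjoint S S') :
    α * (a.1 S + b.1 S') ≤
      a.1 ((A ![a, b]).alloc.1 0) + b.1 ((A ![a, b]).alloc.1 1) := by
  have h := hA ![a, b]
  let o : Allocation 2 m := ⟨![S, S'], fun i j hij => by
    fin_cases i <;> fin_cases j <;> simp_all [disjoint_comm]⟩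
  have h₁ : welfare ![a, b] o ≤ optWelfare ![a, b] :=
    le_ciSup (f := fun o : Allocation 2 m => welfare ![a, b] o) (Set.finite_range _).bddAbove o
  have h₂ : welfare ![a, b] o = a.1 S + b.1 S' := by simp [welfare, o]
  rw [← h₂]
  refine (mul_le_mul_of_nonneg_left h₁ hα).trans (h.trans_eq ?_)
  simp [welfare]

/-- Bidder 0 can buy a bundle containing `S` at an excess price of at most `w`, if the approximation
guarantee forces the rule to sell `S` to a single-minded bidder with weight `w`. -/
theorem le_utility_of_forced {α : ℝ} (hα : 0 ≤ α) (hT : Truthful A) (hA : Approximates A α)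
    {z s b : V} {S : Finset (Fin m)} {w : ℕ} (hs : s.1 = singleVal S w)
    {l : ℝ} (hl : ∀ S, b.1 S ≤ l) (hw : l < α * (w + b.1 Sᶜ)) (a : V)
    (ha : ∀ S S', S ⊆ S' → a.1 S ≤ a.1 S') :
    a.1 S - w - (A ![z, b]).pay 0 ≤ a.1 ((A ![a, b]).alloc.1 0) - (A ![a, b]).pay 0 := by
  -- Not selling `S` leaves welfare at most `l`, too little against giving `S` to bidder 0 and `Sᶜ`
  -- to bidder 1.
  have hsub : S ⊆ (A ![s, b]).alloc.1 0 := by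
    by_contra hn
    have h := le_welfare_of_approximates hα hA s b (disjoint_compl_right (a := S))
    rw [hs] at h
    simp only [singleVal, hn, if_true, if_false, subset_refl] at h
    linarith [hl ((A ![s, b]).alloc.1 1)]
  have h₁ := hT.first s z b
  have h₂ := hT.first a s b
  have h₃ := ha _ _ hsub
  have h₄ : 0 ≤ s.1 ((A ![z, b]).alloc.1 0) := by
    rw [hs]
    unfold singleVal
    split_ifs <;> simp
  have h₅ : s.1 ((A ![s, b]).alloc.1 0) = w := by
    rw [hs]
    simp [singleVal, hsub]
  linarith

/-- A bundle sold at an excess price below `w` is also sold to a single-minded bidder with weight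
`w`, so that the approximation guarantee bounds `w` from below. -/
theorem le_weight_of_sold {α : ℝ} (hα : 0 ≤ α) (hT : Truthful A) (hA : Approximates A α)
    {z s a b : V} {w : ℕ} (hz : ∀ S, z.1 S = 0)
    (hs : s.1 = singleVal ((A ![a, b]).alloc.1 0) w)
    (hb : ∀ S S', S ⊆ S' → b.1 S ≤ b.1 S')
    (hw : (A ![a, b]).pay 0 - (A ![z, b]).pay 0 < w) :
    α * b.1 Finset.univ ≤ w + b.1 ((A ![a, b]).alloc.1 0)ᶜ := by
  have h₁ := hT.first s a b
  have h₂ := hT.first z s b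
  rw [hz, hz] at h₂
  have h₃ : s.1 ((A ![a, b]).alloc.1 0) = w := by simp [hs, singleVal]
  -- Without the bundle, `s` pays at least the zero report's payment, so its utility is at most
  -- minus that; imitating `a` would give more.
  have hsub : (A ![a, b]).alloc.1 0 ⊆ (A ![s, b]).alloc.1 0 := by
    by_contra hn
    have : s.1 ((A ![s, b]).alloc.1 0) = 0 := by simp [hs, singleVal, hn]
    linarith
  have h₄ : s.1 ((A ![s, b]).alloc.1 0) = w := by simp [hs, singleVal, hsub]
  -- The benchmark gives all items to bidder 1.
  have h := le_welfare_of_approximates hα hA s b (disjoint_bot_left (a := Finset.univ))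
  have h₅ : 0 ≤ s.1 ⊥ := by
    rw [hs]
    unfold singleVal
    split_ifs <;> simp
  have h₆ : b.1 ((A ![s, b]).alloc.1 1) ≤ b.1 ((A ![a, b]).alloc.1 0)ᶜ := by
    refine hb _ _ fun x hx => Finset.mem_compl.2 fun hx' => ?_
    exact Finset.disjoint_left.1 ((A ![s, b]).alloc.2 0 1 (by simp)) (hsub hx') hx
  nlinarith [mul_nonneg hα h₅]

end prices

/-! ### Codes -/

/-- Union bound over the `t` positions of agreement; the other `r - t` letters are free. -/
theorem card_agree_le {r n : ℕ} (t : ℕ) (x : Fin r → Fin n) :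
    (Finset.univ.filter fun y : Fin r → Fin n =>
      t ≤ (Finset.univ.filter fun i => x i = y i).card).card ≤ r.choose t * n ^ (r - t) := by
  classical
  have hsub : (Finset.univ.filter fun y : Fin r → Fin n =>
      t ≤ (Finset.univ.filter fun i => x i = y i).card) ⊆
      (Finset.univ.powersetCard t).biUnion fun I : Finset (Fin r) =>
        Fintype.piFinset fun i => if i ∈ I then {x i} else Finset.univ := by
    intro y hy
    obtain ⟨I, hI, hcard⟩ := Finset.exists_subset_card_eq (Finset.mem_filter.1 hy).2
    refine Finset.mem_biUnion.2 ⟨I, Finset.mem_powersetCard.2 ⟨Finset.subset_univ _, hcard⟩, ?_⟩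
    refine Fintype.mem_piFinset.2 fun i => ?_
    split_ifs with h
    · exact Finset.mem_singleton.2 (Finset.mem_filter.1 (hI h)).2.symm
    · exact Finset.mem_univ _
  refine (Finset.card_le_card hsub).trans ?_
  have hcard := Finset.card_biUnion_le_card_mul ((Finset.univ : Finset (Fin r)).powersetCard t)
    (fun I : Finset (Fin r) =>
      Fintype.piFinset fun i => if i ∈ I then {x i} else (Finset.univ : Finset (Fin n)))
    (n ^ (r - t)) (fun I hI => by
      have hI := (Finset.mem_powersetCard.1 hI).2
      rw [Fintype.card_piFinset]
      simp only [apply_ite Finset.card, Finset.card_singleton, Finset.card_univ, Fintype.card_fin]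
      rw [Finset.prod_ite]
      simp [Finset.filter_not, Finset.card_sdiff, hI])
  simpa using hcard

/-- The Gilbert–Varshamov bound, for codes in which distinct words agree in few positions. -/
theorem exists_code {r n t : ℕ} (hn : 0 < n) (ht : t ≤ r) (K : ℕ)
    (hK : K * (r.choose t * n ^ (r - t)) ≤ n ^ r) :
    ∃ x : Fin K → Fin r → Fin n, ∀ i j, i ≠ j →
      (Finset.univ.filter fun s => x i s = x j s).card < t := by
  classical
  induction K with
  | zero => exact ⟨fun i => i.elim0, fun i => i.elim0⟩
  | succ K ih =>
    have h₀ : 0 < r.choose t * n ^ (r - t) := Nat.mul_pos (Nat.choose_pos ht) (pow_pos hn _)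
    obtain ⟨x, hx⟩ := ih ((Nat.mul_le_mul_right _ (Nat.le_succ K)).trans hK)
    -- Greedy choice: the words too close to an earlier codeword do not exhaust the space.
    set bad : Finset (Fin r → Fin n) := Finset.univ.biUnion fun i : Fin K =>
      Finset.univ.filter fun y : Fin r → Fin n =>
        t ≤ (Finset.univ.filter fun s => x i s = y s).card with hbad
    have hcard : bad.card < Fintype.card (Fin r → Fin n) := by
      refine (Finset.card_biUnion_le_card_mul _ _ _ fun i _ => card_agree_le t (x i)).trans_lt ?_
      simp only [Finset.card_univ, Fintype.card_fin, Fintype.card_fun]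
      rw [Nat.succ_mul] at hK
      omega
    obtain ⟨y, hy⟩ : ∃ y, y ∉ bad := by
      by_contra! h
      rw [Finset.eq_univ_iff_forall.2 h] at hcard
      simp at hcard
    have hy' : ∀ i, (Finset.univ.filter fun s => x i s = y s).card < t := by
      intro i
      by_contra! h
      exact hy (Finset.mem_biUnion.2 ⟨i, Finset.mem_univ _, by simpa using h⟩)
    refine ⟨Fin.snoc x y, fun i j => ?_⟩
    induction i using Fin.lastCases with
    | last =>
      induction j using Fin.lastCases with
      | last => simp
      | cast j =>
        intro _
        simpa [eq_comm] using hy' j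
    | cast i =>
      induction j using Fin.lastCases with
      | last =>
        intro _
        simpa using hy' i
      | cast j =>
        intro hij
        simpa using hx i j fun h => hij (by rw [h])

/-- Since `e < 3`, `(6 n)! ≥ (6 n / e) ^ (6 n) ≥ (2 n) ^ (6 n)`; divide `(n ^ 2) ^ (6 n)` by this.
-/
theorem choose_sq_mul_two_pow_le (n : ℕ) (hn : 0 < n) :
    (n ^ 2).choose (6 * n) * 2 ^ (6 * n) ≤ n ^ (6 * n) := by
  have h₁ : ((n ^ 2).choose (6 * n) : ℝ) ≤ ((n ^ 2 : ℕ) : ℝ) ^ (6 * n) / (6 * n).factorial :=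
    Nat.choose_le_pow_div _ _
  have h₂ := Real.pow_div_factorial_le_exp (x := ((6 * n : ℕ) : ℝ)) (Nat.cast_nonneg _) (6 * n)
  have h₃ : Real.exp ((6 * n : ℕ) : ℝ) ≤ 3 ^ (6 * n) := by
    rw [← Real.exp_one_pow]
    exact pow_le_pow_left₀ (Real.exp_pos _).le Real.exp_one_lt_three.le _
  have hfac : (0 : ℝ) < (6 * n).factorial := by positivity
  have hn' : (0 : ℝ) < n := by exact_mod_cast hn
  have h₄ := h₂.trans h₃
  rw [div_le_iff₀ hfac] at h₄
  rw [le_div_iff₀ hfac] at h₁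
  have h₅ : ((6 * n : ℕ) : ℝ) ^ (6 * n) = 3 ^ (6 * n) * (2 ^ (6 * n) * (n : ℝ) ^ (6 * n)) := by
    rw [← mul_pow, ← mul_pow]
    push_cast
    ring_nf
  rw [h₅] at h₄
  have h₆ : 2 ^ (6 * n) * (n : ℝ) ^ (6 * n) ≤ (6 * n).factorial :=
    le_of_mul_le_mul_left h₄ (by positivity)
  have h₇ : ((n ^ 2 : ℕ) : ℝ) ^ (6 * n) = (n : ℝ) ^ (6 * n) * (n : ℝ) ^ (6 * n) := by
    rw [← mul_pow]
    push_cast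
    ring_nf
  rw [h₇] at h₁
  have h₈ := (mul_le_mul_of_nonneg_left h₆ (Nat.cast_nonneg ((n ^ 2).choose (6 * n)))).trans h₁
  rw [← mul_assoc] at h₈
  have h₉ := le_of_mul_le_mul_right h₈ (by positivity)
  exact_mod_cast h₉

/-- A family of `2 ^ (n + 1)` sets of size `n ^ 2` in `n ^ 3` points, with small pairwise
intersections. -/
theorem exists_set_family {m n : ℕ} (hn : 6 ≤ n) (hm : n ^ 3 ≤ m) :
    ∃ T : Fin (2 ^ n) → Bool → Finset (Fin m), (∀ i a, (T i a).card = n ^ 2) ∧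
      ∀ i a j b, (i, a) ≠ (j, b) → (T i a ∩ T j b).card < 6 * n := by
  classical
  have ht : 6 * n ≤ n ^ 2 := by nlinarith
  obtain ⟨x, hx⟩ := exists_code (r := n ^ 2) (n := n) (by omega) ht (2 ^ (n + 1)) (by
    calc 2 ^ (n + 1) * ((n ^ 2).choose (6 * n) * n ^ (n ^ 2 - 6 * n))
        ≤ 2 ^ (6 * n) * ((n ^ 2).choose (6 * n) * n ^ (n ^ 2 - 6 * n)) :=
          Nat.mul_le_mul_right _ (Nat.pow_le_pow_right (by norm_num) (by omega))
      _ = (n ^ 2).choose (6 * n) * 2 ^ (6 * n) * n ^ (n ^ 2 - 6 * n) := by ring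
      _ ≤ n ^ (6 * n) * n ^ (n ^ 2 - 6 * n) :=
          Nat.mul_le_mul_right _ (choose_sq_mul_two_pow_le n (by omega))
      _ = n ^ (n ^ 2) := by rw [← pow_add, Nat.add_sub_cancel' ht])
  obtain ⟨e⟩ : Nonempty (Fin (n ^ 2) × Fin n ↪ Fin m) :=
    Function.Embedding.nonempty_of_card_le (by simpa [← pow_succ] using hm)
  obtain ⟨g⟩ : Nonempty (Fin (2 ^ n) × Bool ≃ Fin (2 ^ (n + 1))) :=
    ⟨Fintype.equivOfCardEq (by simp [pow_succ])⟩
  -- Each set is the graph of a codeword, so intersections count agreements.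
  refine ⟨fun i a => Finset.univ.image fun s => e (s, x (g (i, a)) s), fun i a => ?_,
    fun i a j b hne => ?_⟩
  · rw [Finset.card_image_of_injective _ fun s s' h => (Prod.ext_iff.1 (e.injective h)).1]
    simp
  · refine lt_of_le_of_lt ?_ (hx _ _ (g.injective.ne hne))
    refine (Finset.card_le_card (t := (Finset.univ.filter fun s =>
      x (g (i, a)) s = x (g (j, b)) s).image fun s => e (s, x (g (i, a)) s)) ?_).trans
      Finset.card_image_le
    intro y hy
    obtain ⟨h₁, h₂⟩ := Finset.mem_inter.1 hy
    obtain ⟨s, -, rfl⟩ := Finset.mem_image.1 h₁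
    obtain ⟨s', -, h⟩ := Finset.mem_image.1 h₂
    have h := Prod.ext_iff.1 (e.injective h)
    obtain rfl : s' = s := h.1
    exact Finset.mem_image.2 ⟨s', by simpa using h.2.symm, rfl⟩

/-! ### The hard instances -/

/-- The two bundles are disjoint, and the optimal clauses cover only `(T i)ᶜ` and `T i ∩ T' j`. -/
theorem coverVal_compl_add_coverVal_le {m l t : ℕ} {ι : Type} [Fintype ι] [Nonempty ι]
    {T T' : ι → Finset (Fin m)} (hT : ∀ i, (T i).card = l)
    (hTT' : ∀ i j, (T i ∩ T' j).card ≤ t) (S : Finset (Fin m)) :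
    coverVal (fun i => (T i)ᶜ) S + coverVal T' Sᶜ ≤ (m : ℝ) - l + t := by
  obtain ⟨i, hi⟩ := exists_coverVal_eq (fun i => (T i)ᶜ) S
  obtain ⟨j, hj⟩ := exists_coverVal_eq T' Sᶜ
  rw [hi, hj]
  have h₁ : (S ∩ (T i)ᶜ).card + (Sᶜ ∩ T' j).card ≤ ((T i)ᶜ).card + (T i ∩ T' j).card := by
    have hdis : Disjoint (S ∩ (T i)ᶜ) (Sᶜ ∩ T' j) :=
      disjoint_compl_right.mono Finset.inter_subset_left Finset.inter_subset_left
    rw [← Finset.card_union_of_disjoint hdis]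
    refine (Finset.card_le_card fun x hx => ?_).trans (Finset.card_union_le _ _)
    simp only [Finset.mem_union, Finset.mem_inter, Finset.mem_compl] at hx ⊢
    tauto
  have h₂ : ((T i)ᶜ).card + l = m := by
    rw [← hT i]
    simp
  have h₃ := hTT' i j
  have h₄ : (S ∩ (T i)ᶜ).card + (Sᶜ ∩ T' j).card + l ≤ m + t := by omega
  have h₅ : (((S ∩ (T i)ᶜ).card + (Sᶜ ∩ T' j).card + l : ℕ) : ℝ) ≤ ((m + t : ℕ) : ℝ) := by
    exact_mod_cast h₄
  push_cast at h₅
  linarith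

/-- The communication bound that a family of sets with small pairwise intersections gives. -/
theorem le_cc_of_set_family {m k l t N : ℕ} {V : Set (SetFun m)} (hk : m ≤ k)
    (hV : ∀ v ∈ XOS m ∪ SingleM m, HasPrecision k v → v ∈ V)
    {A : AuctionRule 2 V} (hA : Truthful A) {α : ℝ} (hα : 1 / 2 ≤ α) (hα' : α ≤ 1)
    (hAα : Approximates A α) (hN : 0 < N) (hlm : 2 * l + 2 ≤ m)
    (T : Fin N → Bool → Finset (Fin m)) (hT : ∀ i a, (T i a).card = l)
    (hTT : ∀ i a j b, (i, a) ≠ (j, b) → (T i a ∩ T j b).card ≤ t)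
    (hgap : (l : ℝ) / α + t + 2 < l + α * l) :
    (N : ℕ∞) ≤ cc A := by
  have : Nonempty (Fin N) := ⟨⟨0, hN⟩⟩
  have hα₀ : 0 < α := by linarith
  have hlm' : 2 * (l : ℝ) + 2 ≤ m := by exact_mod_cast hlm
  have hmk : (m : ℝ) ≤ ((2 ^ k : ℕ) : ℝ) := by
    exact_mod_cast hk.trans Nat.lt_two_pow_self.le
  have hsingle : ∀ (S : Finset (Fin m)) (w : ℕ), S.Nonempty ∨ w = 0 → w ≤ 2 ^ k →
      singleVal S w ∈ V := fun S w h hw =>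
    hV _ (Or.inr (singleVal_mem_SingleM h)) (hasPrecision_singleVal hw)
  let v₁ : (Fin N → Bool) → V := fun b =>
    ⟨coverVal fun i => (T i (!b i))ᶜ, hV _ (Or.inl (coverVal_mem_XOS _)) (hasPrecision_coverVal _ hk)⟩
  let v₂ : (Fin N → Bool) → V := fun b =>
    ⟨coverVal fun i => T i (b i), hV _ (Or.inl (coverVal_mem_XOS _)) (hasPrecision_coverVal _ hk)⟩
  let z : V := ⟨singleVal ∅ 0, hsingle ∅ 0 (Or.inr rfl) (Nat.zero_le _)⟩
  have hz : ∀ S, z.1 S = 0 := fun S => by simp [z, singleVal]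
  have hv₂ : ∀ b S, (v₂ b).1 S ≤ l := fun b S => coverVal_le _ (fun i => hT i (b i)) S
  have hv₂' : ∀ b, (v₂ b).1 Finset.univ = l := fun b => by
    refine (hv₂ b _).antisymm ?_
    have := card_le_coverVal (fun i => T i (b i)) Finset.univ ⟨0, hN⟩
    rw [Finset.univ_inter, hT] at this
    exact this
  have hupper : ∀ b, (v₁ b).1 ((A ![v₁ b, v₂ b]).alloc.1 0) - (A ![v₁ b, v₂ b]).pay 0 ≤
      (m : ℝ) - l + t + 1 - α * l - (A ![z, v₂ b]).pay 0 := by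
    intro b
    set S := (A ![v₁ b, v₂ b]).alloc.1 0 with hS
    set p := (A ![v₁ b, v₂ b]).pay 0 with hp
    set p₀ := (A ![z, v₂ b]).pay 0 with hp₀
    have hpp : p₀ ≤ p := by
      have := hA.first z (v₁ b) (v₂ b)
      rw [hz, hz] at this
      linarith
    have hαl : α * l ≤ l := mul_le_of_le_one_left (Nat.cast_nonneg _) hα'
    -- The empty bundle admits no positive-weight single-minded valuation; there the bound follows
    -- from `p₀ ≤ p` and `2 l ≤ m`.
    rcases S.eq_empty_or_nonempty with hS₀ | hS₀
    · have : (v₁ b).1 S = 0 := by simp [v₁, hS₀, coverVal]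
      rw [this]
      have : (0 : ℝ) ≤ t := Nat.cast_nonneg _
      have : (0 : ℝ) ≤ l := Nat.cast_nonneg _
      linarith
    have hsum : (v₁ b).1 S + (v₂ b).1 Sᶜ ≤ (m : ℝ) - l + t := by
      refine coverVal_compl_add_coverVal_le (fun i => hT i _) (fun i j => hTT _ _ _ _ ?_) S
      intro h
      obtain ⟨rfl, h⟩ := Prod.ext_iff.1 h
      simp at h
    have hnn : 0 ≤ (v₂ b).1 Sᶜ := coverVal_nonneg _ _
    have hprice : α * l ≤ p - p₀ + 1 + (v₂ b).1 Sᶜ := by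
      -- A high price gives the claim at once; a low one keeps the rounded weight within the
      -- precision.
      rcases le_or_gt (l : ℝ) (p - p₀) with hl | hl
      · linarith
      have hw₁ : (⌊p - p₀⌋₊ : ℝ) ≤ p - p₀ := Nat.floor_le (by linarith)
      have hw₂ : p - p₀ < (⌊p - p₀⌋₊ + 1 : ℕ) := by
        push_cast
        exact Nat.lt_floor_add_one _
      have hwk : ⌊p - p₀⌋₊ + 1 ≤ 2 ^ k := by
        have : ((⌊p - p₀⌋₊ + 1 : ℕ) : ℝ) ≤ ((2 ^ k : ℕ) : ℝ) := by
          push_cast at hmk ⊢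
          linarith [(Nat.cast_nonneg l : (0 : ℝ) ≤ l)]
        exact_mod_cast this
      have h := le_weight_of_sold hα₀.le hA hAα hz
        (s := ⟨_, hsingle S _ (Or.inl hS₀) hwk⟩) rfl (fun _ _ h => coverVal_mono _ h) hw₂
      rw [hv₂'] at h
      push_cast at h
      linarith
    linarith
  have hlower : ∀ b b', b ≠ b' → (m : ℝ) - l / α - 1 - (A ![z, v₂ b']).pay 0 ≤
      (v₁ b).1 ((A ![v₁ b, v₂ b']).alloc.1 0) - (A ![v₁ b, v₂ b']).pay 0 := by
    intro b b' hne
    obtain ⟨i, hi⟩ := Function.ne_iff.1 hne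
    have hi' : (!b i) = b' i := by
      revert hi
      cases b i <;> cases b' i <;> simp
    have hcard : (((T i (b' i))ᶜ).card : ℝ) = m - l := by
      have := Finset.card_compl_add_card (T i (b' i))
      rw [hT, Fintype.card_fin] at this
      rw [eq_sub_iff_add_eq]
      exact_mod_cast this
    have hne : ((T i (b' i))ᶜ).Nonempty := by
      rw [← Finset.card_pos]
      have : (0 : ℝ) < ((T i (b' i))ᶜ).card := by
        rw [hcard]
        linarith [(Nat.cast_nonneg l : (0 : ℝ) ≤ l)]
      exact_mod_cast this
    have h₁ : (m : ℝ) - l ≤ (v₁ b).1 (T i (b' i))ᶜ := by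
      have := card_le_coverVal (fun i => (T i (!b i))ᶜ) (T i (b' i))ᶜ i
      rw [hi', Finset.inter_self, hcard] at this
      exact this
    have h₂ : (l : ℝ) ≤ (v₂ b').1 (T i (b' i)) := by
      have := card_le_coverVal (fun i => T i (b' i)) (T i (b' i)) i
      rw [Finset.inter_self, hT] at this
      exact this
    have hl₀ : (0 : ℝ) ≤ l := Nat.cast_nonneg _
    have hlα : (l : ℝ) ≤ l / α := le_div_self hl₀ hα₀ hα'
    have hlα' : (l : ℝ) / α ≤ 2 * l := by
      rw [div_le_iff₀ hα₀]
      nlinarith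
    -- `l / α - l` is the weight beyond which the sale is forced; rounding up to an integer costs at
    -- most 1.
    have hw₁ : (⌊(l : ℝ) / α - l⌋₊ : ℝ) ≤ l / α - l := Nat.floor_le (by linarith)
    have hw₂ : (l : ℝ) / α - l < (⌊(l : ℝ) / α - l⌋₊ + 1 : ℕ) := by
      push_cast
      exact Nat.lt_floor_add_one _
    have hwk : ⌊(l : ℝ) / α - l⌋₊ + 1 ≤ 2 ^ k := by
      have : ((⌊(l : ℝ) / α - l⌋₊ + 1 : ℕ) : ℝ) ≤ ((2 ^ k : ℕ) : ℝ) := by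
        push_cast at hmk ⊢
        linarith
      exact_mod_cast this
    have h := le_utility_of_forced hα₀.le hA hAα (z := z)
      (s := ⟨_, hsingle _ _ (Or.inl hne) hwk⟩) (b := v₂ b') rfl (hv₂ b') (by
        rw [compl_compl, ← div_lt_iff₀' hα₀]
        linarith) (v₁ b) (fun _ _ h => coverVal_mono _ h)
    push_cast at h
    linarith
  refine le_cc_of_fooling A v₁ v₂ fun b b' e₁ e₂ e₃ => ?_
  by_contra hne
  -- The zero-report payments for `b` and `b'` may differ; summing over both diagonal and both
  -- crossed profiles cancels them.
  have u₁ := hupper b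
  have u₂ := hupper b'
  have l₁ := hlower b b' hne
  have l₂ := hlower b' b (Ne.symm hne)
  rw [e₂] at l₁
  rw [e₃] at l₂
  rw [← e₁] at u₂
  linarith

/-! ### Choice of parameters -/

/-- The guarantee exceeds the golden ratio by enough to separate the utilities. -/
theorem utility_gap {n : ℕ} {y α : ℝ} (hn : 100 ≤ n) (hny : (n : ℝ) ≤ y) (hyn : y < n + 1)
    (hα : α = (Real.sqrt 5 - 1) / 2 + 3 / y) :
    1 / 2 ≤ α ∧ α ≤ 1 ∧
      ((n ^ 2 : ℕ) : ℝ) / α + (6 * n : ℕ) + 2 < (n ^ 2 : ℕ) + α * (n ^ 2 : ℕ) := by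
  have hn' : (100 : ℝ) ≤ n := by exact_mod_cast hn
  have hy : 0 < y := by linarith
  have hs : Real.sqrt 5 ^ 2 = 5 := Real.sq_sqrt (by norm_num)
  have hs₁ : 2.236 ≤ Real.sqrt 5 := Real.le_sqrt_of_sq_le (by norm_num)
  have hs₂ : Real.sqrt 5 ≤ 2.237 := Real.sqrt_le_iff.2 ⟨by norm_num, by norm_num⟩
  set δ := 3 / y with hδ
  have hδ₀ : 0 < δ := by positivity
  have hδ₁ : δ ≤ 0.03 := by
    rw [hδ, div_le_iff₀ hy]
    linarith
  have hδn : 3 ≤ δ * (n + 1) := by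
    calc (3 : ℝ) = δ * y := by rw [hδ]; field_simp
      _ ≤ δ * (n + 1) := mul_le_mul_of_nonneg_left hyn.le hδ₀.le
  have hα₁ : 1 / 2 ≤ α := by rw [hα]; linarith
  have hα₂ : α ≤ 1 := by rw [hα]; linarith
  refine ⟨hα₁, hα₂, ?_⟩
  have hα₀ : 0 < α := by linarith
  have hquad : 2.236 * δ ≤ α ^ 2 + α - 1 := by
    have : α ^ 2 + α - 1 = Real.sqrt 5 * δ + δ ^ 2 := by
      rw [hα]
      linear_combination hs / 4
    rw [this]
    nlinarith
  -- The constant 3 in the guarantee suffices because `3 √5 > 6`, where 6 comes from the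
  -- intersection bound `6 n`.
  have hmain : 6 * (n : ℝ) + 2 < 2.236 * δ * n ^ 2 := by
    have h₁ : (6 * (n : ℝ) + 2) * (n + 1) < 6.708 * n ^ 2 := by nlinarith
    have h₂ : 6.708 * (n : ℝ) ^ 2 ≤ 2.236 * δ * n ^ 2 * (n + 1) := by
      nlinarith [mul_le_mul_of_nonneg_right hδn (sq_nonneg (n : ℝ))]
    exact lt_of_mul_lt_mul_right (h₁.trans_le h₂) (by linarith)
  push_cast
  have hdiv : (n : ℝ) ^ 2 / α * α = n ^ 2 := div_mul_cancel₀ _ hα₀.ne'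
  have hsq : (0 : ℝ) ≤ n ^ 2 := sq_nonneg _
  refine lt_of_mul_lt_mul_right (a := α) ?_ hα₀.le
  have h₁ : (6 * (n : ℝ) + 2) * α ≤ 6 * n + 2 := mul_le_of_le_one_right (by linarith) hα₂
  have h₂ := mul_le_mul_of_nonneg_left hquad hsq
  nlinarith

end CombAuction

theorem mainTheorem3 :
    ∃ c : ℝ, 0 < c ∧ ∃ (q : Polynomial ℕ) (m₀ : ℕ),
      ∀ m : ℕ, m₀ ≤ m → ∀ k : ℕ, q.eval m ≤ k →
        ∀ V : Set (CombAuction.SetFun m),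
          V ⊆ CombAuction.XOS m ∪ CombAuction.SingleM m →
          (∀ v ∈ CombAuction.XOS m ∪ CombAuction.SingleM m,
            CombAuction.HasPrecision k v → v ∈ V) →
          ∀ A : CombAuction.AuctionRule 2 V,
            CombAuction.Truthful A →
            CombAuction.Approximates A
              ((Real.sqrt 5 - 1) / 2 + 3 * (m : ℝ) ^ (-(1 / 3) : ℝ)) →
            ENNReal.ofReal (Real.exp (c * (m : ℝ) ^ ((1 / 3) : ℝ))) ≤
              ((CombAuction.cc A : ℕ∞) : ENNReal) := by
  refine ⟨1 / 3, by norm_num, Polynomial.X, 101 ^ 3, fun m hm k hk V _ hV A hA hα => ?_⟩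
  rw [Polynomial.eval_X] at hk
  have hm' : (101 : ℝ) ^ 3 ≤ m := by exact_mod_cast hm
  have hm₀ : (0 : ℝ) ≤ m := Nat.cast_nonneg _
  rw [Real.rpow_neg hm₀, ← div_eq_mul_inv] at hα
  set y : ℝ := (m : ℝ) ^ ((1 / 3) : ℝ) with hy
  have hy₀ : 0 ≤ y := Real.rpow_nonneg hm₀ _
  have hy₃ : y ^ 3 = m := by
    rw [hy, ← Real.rpow_natCast, ← Real.rpow_mul hm₀]
    norm_num
  have hy₁ : 101 ≤ y := by
    rw [← hy₃] at hm'
    exact le_of_pow_le_pow_left₀ (by norm_num) hy₀ hm'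
  set n := ⌊y⌋₊ with hn
  have hny : (n : ℝ) ≤ y := Nat.floor_le hy₀
  have hyn : y < n + 1 := Nat.lt_floor_add_one y
  have hn₁ : 100 ≤ n := Nat.le_floor (by push_cast; linarith)
  have hnm : n ^ 3 ≤ m := by
    have : (n : ℝ) ^ 3 ≤ m := hy₃ ▸ pow_le_pow_left₀ (Nat.cast_nonneg n) hny 3
    exact_mod_cast this
  obtain ⟨hα₁, hα₂, hgap⟩ := CombAuction.utility_gap hn₁ hny hyn rfl
  obtain ⟨T, hT, hTT⟩ := CombAuction.exists_set_family (by omega) hnm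
  have hlm : 2 * n ^ 2 + 2 ≤ m := by nlinarith
  have hcc := CombAuction.le_cc_of_set_family hk hV hA hα₁ hα₂ hα (by positivity) hlm T hT
    (fun i a j b h => (hTT i a j b h).le) hgap
  have hexp : Real.exp (1 / 3 * y) ≤ ((2 ^ n : ℕ) : ℝ) := by
    have h₁ : (1 / 3 : ℝ) * y ≤ n * Real.log 2 := by
      have hn' : (100 : ℝ) ≤ n := by exact_mod_cast hn₁
      nlinarith [Real.log_two_gt_d9]
    calc Real.exp (1 / 3 * y) ≤ Real.exp (n * Real.log 2) := Real.exp_le_exp.2 h₁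
      _ = ((2 ^ n : ℕ) : ℝ) := by
        rw [Real.exp_nat_mul, Real.exp_log (by norm_num)]
        push_cast
        rfl
  calc ENNReal.ofReal (Real.exp (1 / 3 * y)) ≤ ENNReal.ofReal ((2 ^ n : ℕ) : ℝ) :=
        ENNReal.ofReal_le_ofReal hexp
    _ = (((2 ^ n : ℕ) : ℕ∞) : ENNReal) := by
        rw [ENNReal.ofReal_natCast]
        simp
    _ ≤ ((CombAuction.cc A : ℕ∞) : ENNReal) := ENat.toENNReal_le.2 hcc
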